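/- Let $X$ be a compact convex set in a (real) locally convex Hausdorff topological vector space. Let $A_c(X)$ be the space of continuous affine functions $X\to\mathbb R$, let $\operatorname{ext}X$ be the set of extreme points of $X$, and let $M_1(\overline{\operatorname{ext}X})$ be the set of Radon probability measures on $X$ supported by $\overline{\operatorname{ext}X}$. A point $x\in X$ is the barycenter of a Radon probability measure $\mu$ on $X$ if $a(x)=\int_X a\,d\mu$ for each $a\in A_c(X)$. A function $u\in A_c(X)$ is called a multiplier for $A_c(X)$ if for each $a\in A_c(X)$ there is $b\in A_c(X)$ with $b=u\cdot a$ on $\operatorname{ext}X$. Let $u\in A_c(X)$. (a) The following assertions are equivalent. (1) $u$ is a multiplier for $A_c(X)$. (2) If $\mu,\nu\in M_1(\overline{\operatorname{ext}X})$ have the same barycenter and $B\subset\mathbb R$ is a Borel set, then $\mu(u^{-1}(B))=\nu(u^{-1}(B))$ and, moreover, if this number is strictly positive, then the probabilities $$\frac{\mu|_{u^{-1}(B)}}{\mu(u^{-1}(B))}\quad\text{and}\quad\frac{\nu|_{u^{-1}(B)}}{\nu(u^{-1}(B))}$$ have the same barycenter. (b) Assume moreover that $X$ is a simplex, i.e.,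 each point of $X$ is the barycenter of exactly one maximal measure, where a Radon probability measure on $X$ is maximal if it is maximal with respect to the order $\mu\prec\nu\iff\int f\,d\mu\le\int f\,d\nu$ for each convex continuous function $f:X\to\mathbb R$. Then $u$ is a multiplier for $A_c(X)$ if and only if $u$ is constant on the support of $\mu$ for each $\mu\in M_1(\overline{\operatorname{ext}X})$ whose barycenter belongs to $\overline{\operatorname{ext}X}$. -/

import Mathlib

open MeasureTheory

noncomputable section

namespace CompactConvex

variable {E : Type*} [AddCommGroup E] [Module ℝ E] [TopologicalSpace E]

/-- The space `A_c(X)` of real-valued continuous affine functions on `X`. -/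
def Ac (X : Set E) : Submodule ℝ C(X, ℝ) where
  carrier := {f | ∀ x y z : X, ∀ s t : ℝ, 0 ≤ s → 0 ≤ t → s + t = 1 →
    (z : E) = s • (x : E) + t • (y : E) → f z = s * f x + t * f y}
  add_mem' := by
    intro f g hf hg x y z s t hs ht hst hz
    simp only [ContinuousMap.add_apply, hf x y z s t hs ht hst hz, hg x y z s t hs ht hst hz]
    ring
  zero_mem' := by
    intro x y z s t hs ht hst hz
    simp
  smul_mem' := by
    intro c f hf x y z s t hs ht hst hz
    simp only [ContinuousMap.smul_apply, smul_eq_mul, hf x y z s t hs ht hst hz]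
    ring

/-- A continuous function on `X` that is convex. -/
def IsConvexFun {X : Set E} (f : C(X, ℝ)) : Prop :=
  ∀ x y z : X, ∀ s t : ℝ, 0 ≤ s → 0 ≤ t → s + t = 1 →
    (z : E) = s • (x : E) + t • (y : E) → f z ≤ s * f x + t * f y

/-- The set `ext X` of extreme points, as a subset of the space `X`. -/
def ext (X : Set E) : Set X := {x | (x : E) ∈ X.extremePoints ℝ}

/-- `u` is a multiplier for `A_c(X)`: for each `a ∈ A_c(X)` there is `b ∈ A_c(X)` with
`b = u * a` on `ext X`. -/
def IsMultiplier {X : Set E} (u : C(X, ℝ)) : Prop :=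
  u ∈ Ac X ∧ ∀ a ∈ Ac X, ∃ b ∈ Ac X, ∀ x ∈ ext X, b x = u x * a x

variable [MeasurableSpace E]

/-- `M₁(F)`: the Radon probability measures on `X` that are supported by `F` (for `F` closed in the
compact space `X`, these are the Radon probability measures on `F`). -/
def M1 {X : Set E} (F : Set X) : Set (Measure X) :=
  {μ | IsProbabilityMeasure μ ∧ μ.Regular ∧ μ Fᶜ = 0}

/-- `x ∈ X` is the barycenter of `μ`: `a(x) = ∫ a dμ` for each `a ∈ A_c(X)`. -/
def IsBarycenter {X : Set E} (μ : Measure X) (x : X) : Prop :=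
  ∀ a ∈ Ac X, a x = ∫ y, a y ∂μ

/-- `μ` and `ν` have the same barycenter. -/
def SameBarycenter {X : Set E} (μ ν : Measure X) : Prop :=
  ∃ x : X, IsBarycenter μ x ∧ IsBarycenter ν x

/-- The dilation order `μ ≺ ν`. -/
def DilationLE {X : Set E} (μ ν : Measure X) : Prop :=
  ∀ f : C(X, ℝ), IsConvexFun f → ∫ x, f x ∂μ ≤ ∫ x, f x ∂ν

/-- `μ` is a Radon probability measure on `X` that is maximal in the dilation order. -/
def IsMaximalMeasure {X : Set E} (μ : Measure X) : Prop :=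
  μ ∈ M1 (Set.univ : Set X) ∧ ∀ ν ∈ M1 (Set.univ : Set X), DilationLE μ ν → ν = μ

/-- `X` is a simplex: each point of `X` is the barycenter of exactly one maximal measure. -/
def IsSimplex (X : Set E) : Prop :=
  ∀ x : X, ∃! μ : Measure X, IsMaximalMeasure μ ∧ IsBarycenter μ x

end CompactConvex

end

/-!
Write `F` for the closure of `ext X`. Everything rests on one application of the Hahn–Banach theorem
and of the Riesz representation theorem, `exists_mem_M1_closure_ext_dilationLE`: a directed family
of probability measures is dominated, for the order `≺`, by a measure supported by `F`, and the
integral of one prescribed function against it can be made as large as its concave majorants on `F`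
permit. Bauer's minimum principle makes the underlying sublinear functional finite.

If `u` is a multiplier, then so is every polynomial in `u`. Hence for measures `μ`, `ν` on `F` with
the same barycenter and for affine `a`, the integrals of `g(u) a` agree for polynomial `g`, so for
continuous `g`, so for indicators of Borel sets (`IsMultiplier.setIntegral_eq`). This is the
equality of the conditional barycenters; these exist by `exists_isBarycenter`. Conversely, the
equality of the conditional barycenters integrates to the statement that the integral of `u a`
against a measure on `F` only depends on the barycenter of the measure, and such a function extends
from `F` to an affine continuous function on `X` (`exists_mem_Ac_eqOn_closure_ext`): the value at
`x` is both an infimum of continuous concave functions and a supremum of continuous convex ones.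

Now let `u` be constant on supports as in the second part. Then `h = u a` satisfies the barycentric
formula at the points of `F`, so on `F` it is a uniform limit of concave majorants and one of convex
minorants, and its integral does not change when a measure on `F` is replaced by a larger one
(`DilationLE.integral_eq_of_barycentric`). On a simplex, two measures with the same barycenter lie
below the same maximal measure, which lives on `F`; so the integral of `h` again only depends on the
barycenter, and `h` extends. In the other direction one compares a measure representing `x ∈ F` with
the Dirac measure at `x`.
-/

namespace CompactConvex

open Filter Topology

section

/-! ### Measures supported by a closed set -/

section Measures

variable {E : Type*} [TopologicalSpace E] [MeasurableSpace E] {X : Set E}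

lemma M1_subset_univ {F : Set X} {μ : Measure X} (hμ : μ ∈ M1 F) : μ ∈ M1 (Set.univ : Set X) :=
  ⟨hμ.1, hμ.2.1, by simp⟩

lemma ae_mem_of_mem_M1 {F : Set X} {μ : Measure X} (hμ : μ ∈ M1 F) : ∀ᵐ x ∂μ, x ∈ F :=
  mem_ae_iff.2 hμ.2.2

lemma integral_congr_of_mem_M1 {F : Set X} {μ : Measure X} (hμ : μ ∈ M1 F) {f g : X → ℝ}
    (h : ∀ x ∈ F, f x = g x) : ∫ x, f x ∂μ = ∫ x, g x ∂μ :=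
  integral_congr_ae <| (ae_mem_of_mem_M1 hμ).mono h

variable [BorelSpace E]

lemma integrable_continuousMap [CompactSpace X] (f : C(X, ℝ)) (μ : Measure X)
    [IsFiniteMeasure μ] : Integrable f μ :=
  f.continuous.integrable_of_hasCompactSupport (HasCompactSupport.of_compactSpace f)

lemma integral_mono_of_mem_M1 [CompactSpace X] {F : Set X} {μ : Measure X} (hμ : μ ∈ M1 F)
    {f g : C(X, ℝ)} (h : ∀ x ∈ F, f x ≤ g x) : ∫ x, f x ∂μ ≤ ∫ x, g x ∂μ := by
  have := hμ.1
  exact integral_mono_ae (integrable_continuousMap f μ) (integrable_continuousMap g μ)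
    ((ae_mem_of_mem_M1 hμ).mono h)

/-- A linear functional on `C(X)` that is positive on a closed set `F` and normalized is
integration against a Radon probability measure supported by `F`. -/
lemma exists_mem_M1_integral_eq [T2Space E] [CompactSpace X] {F : Set X} (hF : IsClosed F)
    (φ : C(X, ℝ) →ₗ[ℝ] ℝ) (hφ : ∀ g, (∀ x ∈ F, g x ≤ 0) → φ g ≤ 0) (hφ₁ : φ 1 = 1) :
    ∃ μ ∈ M1 F, ∀ g : C(X, ℝ), ∫ x, g x ∂μ = φ g := by
  let Λ : CompactlySupportedContinuousMap X ℝ →ₚ[ℝ] ℝ := PositiveLinearMap.mk₀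
    { toFun := fun g ↦ φ g.toContinuousMap
      map_add' := fun f g ↦ φ.map_add f.toContinuousMap g.toContinuousMap
      map_smul' := fun c g ↦ φ.map_smul c g.toContinuousMap } <| by
    intro g hg
    have h := hφ (-g.toContinuousMap) fun x _ ↦ neg_nonpos.2 (hg x)
    rw [map_neg] at h
    exact neg_nonpos.1 h
  have hint : ∀ g : C(X, ℝ), ∫ x, g x ∂(RealRMK.rieszMeasure Λ) = φ g := fun g ↦
    RealRMK.integral_rieszMeasure Λ (CompactlySupportedContinuousMap.continuousMapEquiv g)
  have hprob : IsProbabilityMeasure (RealRMK.rieszMeasure Λ) := by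
    have h := hint 1
    simp only [ContinuousMap.one_apply, integral_const, smul_eq_mul, mul_one, hφ₁] at h
    exact ⟨by simpa [Measure.real, ENNReal.toReal_eq_one_iff] using h⟩
  refine ⟨RealRMK.rieszMeasure Λ, ⟨hprob, inferInstance, ?_⟩, hint⟩
  rw [hF.isOpen_compl.measure_eq_iSup_isCompact]
  simp only [ENNReal.iSup_eq_zero]
  intro K hKF hK
  obtain ⟨g, hg₀, hg₁, hg⟩ := exists_continuous_zero_one_of_isClosed hF hK.isClosed
    (Set.disjoint_left.2 fun x hx hxK ↦ hKF hxK hx)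
  refine le_antisymm ((RealRMK.rieszMeasure_le_of_eq_one Λ
    (f := CompactlySupportedContinuousMap.continuousMapEquiv g) (fun x ↦ (hg x).1) hK
    fun x hx ↦ hg₁ hx).trans ?_) zero_le
  have : φ g ≤ 0 := hφ g fun x hx ↦ (hg₀ hx).le
  exact (ENNReal.ofReal_eq_zero.2 this).le

end Measures

/-! ### Convex functions and the minimum principle -/

variable {E : Type*} [AddCommGroup E] [Module ℝ E] [TopologicalSpace E] {X : Set E}

lemma const_mem_Ac (c : ℝ) : ContinuousMap.const X c ∈ Ac X := by
  intro x y z s t _ _ hst _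
  simp [← add_mul, hst]

lemma one_mem_Ac : (1 : C(X, ℝ)) ∈ Ac X := const_mem_Ac 1

/-- An affine continuous function is the difference of a nonnegative one and a constant. -/
lemma exists_nonneg_add_const [CompactSpace X] {a : C(X, ℝ)} (ha : a ∈ Ac X) :
    ∃ c : ℝ, 0 ≤ a + ContinuousMap.const X c ∧ a + ContinuousMap.const X c ∈ Ac X := by
  refine ⟨‖a‖, fun x ↦ ?_, (Ac X).add_mem ha (const_mem_Ac _)⟩
  exact neg_le_iff_add_nonneg.1 (a.neg_norm_le_apply x)

lemma isConvexFun_of_mem_Ac {a : C(X, ℝ)} (ha : a ∈ Ac X) : IsConvexFun a :=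
  fun x y z s t hs ht hst hz ↦ (ha x y z s t hs ht hst hz).le

lemma IsConvexFun.add {f g : C(X, ℝ)} (hf : IsConvexFun f) (hg : IsConvexFun g) :
    IsConvexFun (f + g) := by
  intro x y z s t hs ht hst hz
  have h₁ := hf x y z s t hs ht hst hz
  have h₂ := hg x y z s t hs ht hst hz
  simp only [ContinuousMap.add_apply]
  linarith

lemma IsConvexFun.smul {f : C(X, ℝ)} (hf : IsConvexFun f) {c : ℝ} (hc : 0 ≤ c) :
    IsConvexFun (c • f) := by
  intro x y z s t hs ht hst hz
  have h := mul_le_mul_of_nonneg_left (hf x y z s t hs ht hst hz) hc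
  simp only [ContinuousMap.smul_apply, smul_eq_mul]
  linarith

lemma IsConvexFun.sup {f g : C(X, ℝ)} (hf : IsConvexFun f) (hg : IsConvexFun g) :
    IsConvexFun (f ⊔ g) := by
  intro x y z s t hs ht hst hz
  have h₁ := hf x y z s t hs ht hst hz
  have h₂ := hg x y z s t hs ht hst hz
  simp only [ContinuousMap.sup_apply]
  refine sup_le (h₁.trans ?_) (h₂.trans ?_) <;> gcongr <;> simp

/-- **Bauer's minimum principle**: a continuous concave function on a compact set is bounded below
by its values at extreme points. -/
lemma exists_mem_ext_apply_le [IsTopologicalAddGroup E] [ContinuousSMul ℝ E]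
    [LocallyConvexSpace ℝ E] [T2Space E] [CompactSpace X] {k : C(X, ℝ)} (hk : IsConvexFun (-k))
    (x : X) : ∃ e ∈ ext X, k e ≤ k x := by
  obtain ⟨m, -, hm⟩ := isCompact_univ.exists_isMinOn ⟨x, Set.mem_univ x⟩ k.continuous.continuousOn
  replace hm : ∀ y, k m ≤ k y := fun y ↦ hm (Set.mem_univ y)
  -- The minimizers form a compact face of `X`, and an extreme point of a face is extreme in `X`.
  let A : Set E := Subtype.val '' {y : X | k y = k m}
  have hA : IsCompact A :=
    (isClosed_eq k.continuous continuous_const).isCompact.image continuous_subtype_val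
  obtain ⟨e, he⟩ := hA.extremePoints_nonempty ⟨m, m, rfl, rfl⟩
  obtain ⟨⟨e', he', rfl⟩, heA⟩ := mem_extremePoints.1 he
  refine ⟨e', mem_extremePoints.2 ⟨e'.2, ?_⟩, he'.le.trans (hm x)⟩
  rintro y hy z hz ⟨s, t, hs, ht, hst, hyz⟩
  have h := hk ⟨y, hy⟩ ⟨z, hz⟩ e' s t hs.le ht.le hst hyz.symm
  simp only [ContinuousMap.neg_apply] at h
  have hy' := hm ⟨y, hy⟩
  have hz' := hm ⟨z, hz⟩
  have he'' : k e' = k m := he'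
  have hm' : k m = s * k m + t * k m := by rw [← add_mul, hst, one_mul]
  have h₁ : s * k m ≤ s * k ⟨y, hy⟩ := by gcongr
  have h₂ : t * k m ≤ t * k ⟨z, hz⟩ := by gcongr
  refine heA y ⟨⟨y, hy⟩, ?_, rfl⟩ z ⟨⟨z, hz⟩, ?_, rfl⟩ ⟨s, t, hs, ht, hst, hyz⟩
  · exact (mul_left_cancel₀ hs.ne' (by linarith : s * k m = s * k ⟨y, hy⟩)).symm
  · exact (mul_left_cancel₀ ht.ne' (by linarith : t * k m = t * k ⟨z, hz⟩)).symm

lemma le_of_forall_closure_ext_le [IsTopologicalAddGroup E] [ContinuousSMul ℝ E]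
    [LocallyConvexSpace ℝ E] [T2Space E] [CompactSpace X] {k : C(X, ℝ)} (hk : IsConvexFun (-k))
    {c : ℝ} (h : ∀ x ∈ closure (ext X), c ≤ k x) (x : X) : c ≤ k x := by
  obtain ⟨e, he, hex⟩ := exists_mem_ext_apply_le hk x
  exact (h e (subset_closure he)).trans hex

/-! ### Domination by measures on the closure of the extreme points -/

variable [MeasurableSpace E] [BorelSpace E]

/-- The **Hahn–Banach construction of measures**. Every nonempty family `C` of Radon probability
measures directed for `≺` is dominated by a single measure supported by the closure of `ext X`,
and its integral of a given `g₀` can be made as large as the domination allows. It serves as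
the existence of representing measures (`C` a Dirac measure), as the absorption of a measure by one
living on the closure of `ext X` (`C` a singleton), and as the bound of a chain in Zorn's lemma.
Throughout, concavity of `k` is expressed as `IsConvexFun (-k)`. -/
lemma exists_mem_M1_closure_ext_dilationLE [IsTopologicalAddGroup E] [ContinuousSMul ℝ E]
    [LocallyConvexSpace ℝ E] [T2Space E] [CompactSpace X] {C : Set (Measure X)}
    (hC : C ⊆ M1 (Set.univ : Set X)) (hne : C.Nonempty) (hdir : DirectedOn DilationLE C)
    (g₀ : C(X, ℝ)) :
    ∃ μ ∈ M1 (closure (ext X)), (∀ ν ∈ C, DilationLE ν μ) ∧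
      ∀ r : ℝ, (∀ ν ∈ C, ∀ k : C(X, ℝ), IsConvexFun (-k) → (∀ x ∈ closure (ext X), g₀ x ≤ k x) →
        r ≤ ∫ x, k x ∂ν) → r ≤ ∫ x, g₀ x ∂μ := by
  -- `p g` is the infimum over `ν ∈ C` of the integrals of the concave majorants of `g` on the
  -- closure of `ext X`; the minimum principle bounds it from below.
  let S : C(X, ℝ) → Set ℝ := fun g ↦ {r | ∃ ν ∈ C, ∃ k : C(X, ℝ), IsConvexFun (-k) ∧
    (∀ x ∈ closure (ext X), g x ≤ k x) ∧ r = ∫ x, k x ∂ν}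
  let p : C(X, ℝ) → ℝ := fun g ↦ sInf (S g)
  have hlow : ∀ (g : C(X, ℝ)) (c : ℝ), (∀ x ∈ closure (ext X), c ≤ g x) → ∀ r ∈ S g, c ≤ r := by
    rintro g c hc _ ⟨ν, hν, k, hk, hgk, rfl⟩
    have := (hC hν).1
    have h := le_of_forall_closure_ext_le hk fun x hx ↦ (hc x hx).trans (hgk x hx)
    calc c = ∫ _, c ∂ν := by simp
      _ ≤ ∫ x, k x ∂ν := integral_mono (integrable_const c) (integrable_continuousMap k ν) h
  have hbdd : ∀ g, BddBelow (S g) := fun g ↦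
    ⟨-‖g‖, fun r hr ↦ hlow g _ (fun x _ ↦ g.neg_norm_le_apply x) r hr⟩
  have hmem : ∀ ν ∈ C, ∀ k : C(X, ℝ), IsConvexFun (-k) → ∀ g : C(X, ℝ),
      (∀ x ∈ closure (ext X), g x ≤ k x) → p g ≤ ∫ x, k x ∂ν :=
    fun ν hν k hk g hgk ↦ csInf_le (hbdd g) ⟨ν, hν, k, hk, hgk, rfl⟩
  have hSne : ∀ g, (S g).Nonempty := fun g ↦ by
    obtain ⟨ν, hν⟩ := hne
    exact ⟨_, ν, hν, ContinuousMap.const X ‖g‖,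
      isConvexFun_of_mem_Ac ((Ac X).neg_mem (const_mem_Ac _)), fun x _ ↦ g.apply_le_norm x, rfl⟩
  have hle : ∀ c > (0 : ℝ), ∀ g, p (c • g) ≤ c * p g := by
    intro c hc g
    rw [← div_le_iff₀' hc]
    refine le_csInf (hSne g) ?_
    rintro _ ⟨ν, hν, k, hk, hgk, rfl⟩
    rw [div_le_iff₀' hc]
    refine (hmem ν hν (c • k) (by simpa using hk.smul hc.le) _ fun x hx ↦ ?_).trans_eq ?_
    · simpa using mul_le_mul_of_nonneg_left (hgk x hx) hc.le
    · simp [integral_const_mul]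
  have hhom : ∀ c : ℝ, 0 < c → ∀ g, p (c • g) = c * p g := by
    intro c hc g
    refine (hle c hc g).antisymm ?_
    have h := hle c⁻¹ (inv_pos.2 hc) (c • g)
    rwa [inv_smul_smul₀ hc.ne', ← div_eq_inv_mul, le_div_iff₀' hc] at h
  have hadd : ∀ f g, p (f + g) ≤ p f + p g := by
    intro f g
    rw [← sub_le_iff_le_add]
    refine le_csInf (hSne f) ?_
    rintro _ ⟨ν, hν, k, hk, hfk, rfl⟩
    rw [sub_le_comm]
    refine le_csInf (hSne g) ?_
    rintro _ ⟨ν', hν', k', hk', hgk', rfl⟩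
    -- Passing to a larger measure decreases the integrals of concave functions.
    obtain ⟨ρ, hρ, hνρ, hν'ρ⟩ := hdir ν hν ν' hν'
    have := (hC hρ).1
    have h := hmem ρ hρ (k + k') (by rw [neg_add]; exact hk.add hk') (f + g)
      fun x hx ↦ add_le_add (hfk x hx) (hgk' x hx)
    simp only [ContinuousMap.add_apply] at h
    rw [integral_add (integrable_continuousMap k ρ) (integrable_continuousMap k' ρ)] at h
    have h₁ := hνρ _ hk
    have h₂ := hν'ρ _ hk'
    simp only [ContinuousMap.neg_apply, integral_neg] at h₁ h₂
    linarith
  have hp₀ : p 0 = 0 := by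
    have h := hhom 2 two_pos 0
    rw [smul_zero] at h
    linarith
  -- Extend the functional `t • g₀ ↦ t * p g₀` to a linear functional dominated by `p`.
  obtain ⟨φ, hφ, hφp⟩ := exists_extension_of_le_sublinear
    (LinearPMap.mkSpanSingleton' g₀ (p g₀) (σ := RingHom.id ℝ) (by
      intro c hc
      rcases smul_eq_zero.1 hc with rfl | rfl <;> simp [hp₀])) p hhom hadd (by
    rintro ⟨y, hy⟩
    obtain ⟨t, rfl⟩ := Submodule.mem_span_singleton.1 hy
    rw [LinearPMap.mkSpanSingleton'_apply]
    simp only [RingHom.id_apply, smul_eq_mul]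
    rcases lt_trichotomy t 0 with ht | rfl | ht
    · have h₁ := hadd (t • g₀) ((-t) • g₀)
      rw [← add_smul, add_neg_cancel, zero_smul, hp₀, hhom (-t) (neg_pos.2 ht)] at h₁
      linarith
    · simp [hp₀]
    · exact (hhom t ht g₀).ge)
  have hφ₀ : φ g₀ = p g₀ := (hφ ⟨g₀, Submodule.mem_span_singleton_self g₀⟩).trans
    (LinearPMap.mkSpanSingleton'_apply_self g₀ (p g₀) _ _)
  obtain ⟨ν₀, hν₀⟩ := hne
  have hcc : ∀ c : ℝ, φ (ContinuousMap.const X c) ≤ c := fun c ↦ by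
    have := (hC hν₀).1
    refine (hφp _).trans ((hmem ν₀ hν₀ (ContinuousMap.const X c)
      (isConvexFun_of_mem_Ac ((Ac X).neg_mem (const_mem_Ac _))) _ fun x _ ↦ le_rfl).trans ?_)
    simp
  obtain ⟨μ, hμ, hμφ⟩ := exists_mem_M1_integral_eq isClosed_closure φ (fun g hg ↦ by
      refine (hφp g).trans ((hmem ν₀ hν₀ 0 ?_ g (by simpa using hg)).trans (by simp))
      simpa using isConvexFun_of_mem_Ac (Ac X).zero_mem) (by
      refine le_antisymm (hcc 1) ?_
      have h := hcc (-1)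
      have h' : ContinuousMap.const X (-1 : ℝ) = -1 := rfl
      rw [h', map_neg] at h
      linarith)
  refine ⟨μ, hμ, fun ν hν f hf ↦ ?_, fun r hr ↦ ?_⟩
  · have h := (hφp (-f)).trans (hmem ν hν (-f) (by simpa using hf) _ fun x _ ↦ le_rfl)
    simp only [map_neg, ContinuousMap.neg_apply, integral_neg] at h
    rw [hμφ]
    linarith
  · rw [hμφ, hφ₀]
    refine le_csInf (hSne _) ?_
    rintro _ ⟨ν, hν, k, hk, hgk, rfl⟩
    exact hr ν hν k hk hgk

end

section

/-! ### Measures determined by their integrals -/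

lemma integral_cond_eq {Ω : Type*} [MeasurableSpace Ω] {μ : Measure Ω} {s : Set Ω} {f : Ω → ℝ} :
    ∫ x, f x ∂(ProbabilityTheory.cond μ s) = (μ.real s)⁻¹ * ∫ x in s, f x ∂μ := by
  rw [ProbabilityTheory.cond, integral_smul_measure, ENNReal.toReal_inv, smul_eq_mul]
  rfl

section Measures

variable {E : Type*} [TopologicalSpace E] [MeasurableSpace E] [BorelSpace E] {X : Set E}

lemma integral_mul_indicator_comp (u a : C(X, ℝ)) (μ : Measure X) {B : Set ℝ}
    (hB : MeasurableSet B) :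
    ∫ x, B.indicator 1 (u x) * a x ∂μ = ∫ x in u ⁻¹' B, a x ∂μ := by
  rw [← integral_indicator (u.continuous.measurable hB)]
  refine integral_congr_ae (Eventually.of_forall fun x ↦ ?_)
  by_cases h : u x ∈ B <;> simp [Set.indicator, h]

lemma integral_map_withDensity {u a : C(X, ℝ)} (ha : 0 ≤ a) (μ : Measure X) {g : ℝ → ℝ}
    (hg : Measurable g) :
    ∫ t, g t ∂(μ.withDensity fun x ↦ ENNReal.ofReal (a x)).map u = ∫ x, g (u x) * a x ∂μ := by
  rw [integral_map u.continuous.aemeasurable hg.aestronglyMeasurable]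
  refine (integral_withDensity_eq_integral_smul (f := fun x ↦ (a x).toNNReal)
    a.continuous.measurable.real_toNNReal _).trans ?_
  refine integral_congr_ae (Eventually.of_forall fun x ↦ ?_)
  have h : ((a x).toNNReal : ℝ) = a x := Real.coe_toNNReal _ (ha x)
  simp only [NNReal.smul_def, h, smul_eq_mul, mul_comm]

variable [CompactSpace X]

lemma continuous_integral_continuousMap (μ : Measure X) [IsFiniteMeasure μ] :
    Continuous fun g : C(X, ℝ) ↦ ∫ x, g x ∂μ := by
  let φ : C(X, ℝ) →ₗ[ℝ] ℝ :=
    { toFun := fun g ↦ ∫ x, g x ∂μ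
      map_add' := fun f g ↦
        integral_add (integrable_continuousMap f μ) (integrable_continuousMap g μ)
      map_smul' := fun c g ↦ integral_const_mul c _ }
  refine AddMonoidHomClass.continuous_of_bound φ (μ.real Set.univ) fun g ↦ ?_
  rw [mul_comm]
  exact norm_integral_le_of_norm_le_const (Eventually.of_forall g.norm_coe_le_norm)

lemma isFiniteMeasure_map_withDensity (u a : C(X, ℝ)) (μ : Measure X) [IsFiniteMeasure μ] :
    IsFiniteMeasure ((μ.withDensity fun x ↦ ENNReal.ofReal (a x)).map u) := by
  have := isFiniteMeasure_withDensity_ofReal (integrable_continuousMap a μ).2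
  infer_instance

lemma setIntegral_preimage_eq_of_forall_continuous {u a : C(X, ℝ)} (ha : 0 ≤ a)
    {μ ν : Measure X} [IsFiniteMeasure μ] [IsFiniteMeasure ν]
    (h : ∀ g : C(ℝ, ℝ), ∫ x, g (u x) * a x ∂μ = ∫ x, g (u x) * a x ∂ν) {B : Set ℝ}
    (hB : MeasurableSet B) : ∫ x in u ⁻¹' B, a x ∂μ = ∫ x in u ⁻¹' B, a x ∂ν := by
  have := isFiniteMeasure_map_withDensity u a μ
  have := isFiniteMeasure_map_withDensity u a ν
  have hmap : (μ.withDensity fun x ↦ ENNReal.ofReal (a x)).map u =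
      (ν.withDensity fun x ↦ ENNReal.ofReal (a x)).map u := by
    refine ext_of_forall_integral_eq_of_IsFiniteMeasure fun g ↦ ?_
    rw [integral_map_withDensity ha μ g.continuous.measurable,
      integral_map_withDensity ha ν g.continuous.measurable]
    exact h g.toContinuousMap
  have hind : Measurable (B.indicator (1 : ℝ → ℝ)) := measurable_one.indicator hB
  rw [← integral_mul_indicator_comp u a μ hB, ← integral_mul_indicator_comp u a ν hB,
    ← integral_map_withDensity ha μ hind, ← integral_map_withDensity ha ν hind, hmap]

lemma integral_mul_eq_of_forall_setIntegral {u a : C(X, ℝ)} (ha : 0 ≤ a)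
    {μ ν : Measure X} [IsFiniteMeasure μ] [IsFiniteMeasure ν]
    (h : ∀ B : Set ℝ, MeasurableSet B → ∫ x in u ⁻¹' B, a x ∂μ = ∫ x in u ⁻¹' B, a x ∂ν) :
    ∫ x, u x * a x ∂μ = ∫ x, u x * a x ∂ν := by
  have hmap : (μ.withDensity fun x ↦ ENNReal.ofReal (a x)).map u =
      (ν.withDensity fun x ↦ ENNReal.ofReal (a x)).map u := by
    ext B hB
    have hB' := u.continuous.measurable hB
    rw [Measure.map_apply u.continuous.measurable hB, Measure.map_apply u.continuous.measurable hB,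
      withDensity_apply _ hB', withDensity_apply _ hB',
      ← ofReal_integral_eq_lintegral_ofReal (integrable_continuousMap a _)
        (Eventually.of_forall ha),
      ← ofReal_integral_eq_lintegral_ofReal (integrable_continuousMap a _)
        (Eventually.of_forall ha), h B hB]
  have h' := integral_map_withDensity (u := u) ha μ measurable_id
  rw [hmap, integral_map_withDensity ha ν measurable_id] at h'
  exact h'.symm

/-- The Dirac measure at `x`, as a member of `M1 {x}`. -/
lemma exists_mem_M1_singleton [T2Space E] (x : X) :
    ∃ δ ∈ M1 {x}, ∀ g : C(X, ℝ), ∫ y, g y ∂δ = g x :=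
  exists_mem_M1_integral_eq isClosed_singleton
    (ContinuousMap.evalCLM ℝ x : C(X, ℝ) →L[ℝ] ℝ).toLinearMap (fun _ h ↦ h x rfl) rfl

end Measures

lemma mem_M1_of_subset {E : Type*} [TopologicalSpace E] [MeasurableSpace E] {X : Set E}
    {F G : Set X} (h : F ⊆ G) {μ : Measure X} (hμ : μ ∈ M1 F) : μ ∈ M1 G :=
  ⟨hμ.1, hμ.2.1, measure_mono_null (Set.compl_subset_compl.2 h) hμ.2.2⟩

/-! ### Barycenters -/

variable {E : Type*} [AddCommGroup E] [Module ℝ E] [TopologicalSpace E] [MeasurableSpace E]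
  {X : Set E}

lemma SameBarycenter.integral_eq {μ ν : Measure X} (h : SameBarycenter μ ν) {a : C(X, ℝ)}
    (ha : a ∈ Ac X) : ∫ x, a x ∂μ = ∫ x, a x ∂ν := by
  obtain ⟨x, hμ, hν⟩ := h
  rw [← hμ a ha, hν a ha]

lemma DilationLE.trans {μ ν ρ : Measure X} (h₁ : DilationLE μ ν) (h₂ : DilationLE ν ρ) :
    DilationLE μ ρ := fun f hf ↦ (h₁ f hf).trans (h₂ f hf)

lemma DilationLE.refl (μ : Measure X) : DilationLE μ μ := fun _ _ ↦ le_rfl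

lemma DilationLE.integral_eq {μ ν : Measure X} (h : DilationLE μ ν) {a : C(X, ℝ)}
    (ha : a ∈ Ac X) : ∫ x, a x ∂μ = ∫ x, a x ∂ν := by
  refine (h a (isConvexFun_of_mem_Ac ha)).antisymm ?_
  have h' := h (-a) (isConvexFun_of_mem_Ac ((Ac X).neg_mem ha))
  simp only [ContinuousMap.neg_apply, integral_neg] at h'
  exact neg_le_neg_iff.1 h'

lemma DilationLE.isBarycenter {μ ν : Measure X} (h : DilationLE μ ν) {x : X}
    (hx : IsBarycenter μ x) : IsBarycenter ν x :=
  fun a ha ↦ (hx a ha).trans (h.integral_eq ha)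

lemma DilationLE.integral_concave_le {μ ν : Measure X} (h : DilationLE μ ν) {k : C(X, ℝ)}
    (hk : IsConvexFun (-k)) : ∫ x, k x ∂ν ≤ ∫ x, k x ∂μ := by
  have h' := h (-k) hk
  simp only [ContinuousMap.neg_apply, integral_neg] at h'
  exact neg_le_neg_iff.1 h'

variable [BorelSpace E]

/-- Every probability measure on a compact convex set has a barycenter: finitely many affine
conditions can be met since the mean of a finite-dimensional affine image of `X` stays in that
compact convex image, and compactness takes care of all conditions together. -/
lemma exists_isBarycenter [CompactSpace X] (hX : Convex ℝ X) (μ : Measure X)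
    [IsProbabilityMeasure μ] : ∃ x, IsBarycenter μ x := by
  suffices h : (⋂ a : Ac X, {x : X | a.1 x = ∫ y, a.1 y ∂μ}).Nonempty by
    obtain ⟨x, hx⟩ := h
    exact ⟨x, fun a ha ↦ Set.mem_iInter.1 hx ⟨a, ha⟩⟩
  refine CompactSpace.iInter_nonempty (fun a ↦ isClosed_eq a.1.continuous continuous_const) ?_
  intro s
  let f : X → s → ℝ := fun x i ↦ i.1.1 x
  have hf : Continuous f := continuous_pi fun i ↦ i.1.1.continuous
  have hfi : ∀ i, Integrable (f · i) μ := fun i ↦ integrable_continuousMap i.1.1 μ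
  have hconv : Convex ℝ (Set.range f) := by
    rintro _ ⟨x, rfl⟩ _ ⟨y, rfl⟩ p q hp hq hpq
    refine ⟨⟨_, hX x.2 y.2 hp hq hpq⟩, funext fun i ↦ ?_⟩
    simpa [f] using i.1.2 x y _ p q hp hq hpq rfl
  obtain ⟨x, hx⟩ := hconv.integral_mem (isCompact_range hf).isClosed
    (Eventually.of_forall fun x ↦ Set.mem_range_self x) (Integrable.of_eval hfi)
  refine ⟨x, Set.mem_iInter₂.2 fun a ha ↦ ?_⟩
  have h := congrFun hx ⟨a, ha⟩
  rwa [eval_integral hfi] at h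

/-- Every point has a representing measure on the closure of `ext X`, whose integral of a given `g`
can be made at least the infimum at that point of the concave majorants of `g`. -/
lemma exists_mem_M1_closure_ext_isBarycenter [IsTopologicalAddGroup E] [ContinuousSMul ℝ E]
    [LocallyConvexSpace ℝ E] [T2Space E] [CompactSpace X] (x : X) (g : C(X, ℝ)) :
    ∃ μ ∈ M1 (closure (ext X)), IsBarycenter μ x ∧
      (∀ k : C(X, ℝ), IsConvexFun (-k) → ∫ y, k y ∂μ ≤ k x) ∧
      ∀ r : ℝ, (∀ k : C(X, ℝ), IsConvexFun (-k) → (∀ y ∈ closure (ext X), g y ≤ k y) → r ≤ k x) →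
        r ≤ ∫ y, g y ∂μ := by
  obtain ⟨δ, hδ, hδx⟩ := exists_mem_M1_singleton x
  obtain ⟨μ, hμ, hδμ, hr⟩ := exists_mem_M1_closure_ext_dilationLE (C := {δ})
    (Set.singleton_subset_iff.2 (M1_subset_univ hδ)) (Set.singleton_nonempty δ)
    (fun _ h₁ _ h₂ ↦ ⟨δ, rfl, h₁ ▸ DilationLE.refl δ, h₂ ▸ DilationLE.refl δ⟩) g
  have hle := hδμ δ rfl
  refine ⟨μ, hμ, hle.isBarycenter fun a _ ↦ (hδx a).symm,
    fun k hk ↦ (hle.integral_concave_le hk).trans_eq (hδx k), fun r hkr ↦ hr r ?_⟩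
  rintro _ rfl k hk hgk
  rw [hδx]
  exact hkr k hk hgk

/-! ### Multipliers and disintegration along the level sets -/

/-- The algebra of all `g ∈ C(X)` for which `g * a` agrees on `ext X` with an element of `A_c(X)`
whenever `a ∈ A_c(X)`. -/
def multiplierAlgebra (X : Set E) : Subalgebra ℝ C(X, ℝ) where
  carrier := {g | ∀ a ∈ Ac X, ∃ b ∈ Ac X, ∀ x ∈ ext X, b x = g x * a x}
  mul_mem' := by
    intro f g hf hg a ha
    obtain ⟨b, hb, hba⟩ := hg a ha
    obtain ⟨c, hc, hcb⟩ := hf b hb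
    exact ⟨c, hc, fun x hx ↦ by rw [hcb x hx, hba x hx, ContinuousMap.mul_apply, mul_assoc]⟩
  add_mem' := by
    intro f g hf hg a ha
    obtain ⟨b, hb, hba⟩ := hf a ha
    obtain ⟨c, hc, hca⟩ := hg a ha
    exact ⟨b + c, (Ac X).add_mem hb hc, fun x hx ↦ by
      rw [ContinuousMap.add_apply, hba x hx, hca x hx, ContinuousMap.add_apply, add_mul]⟩
  algebraMap_mem' := fun r a ha ↦ ⟨r • a, (Ac X).smul_mem r ha, fun _ _ ↦ rfl⟩

/-- If `u` is a multiplier then so is every polynomial in `u`, and by Weierstrass' theorem the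
integral of `g(u) a` only depends on the barycenter for every continuous `g`. -/
lemma IsMultiplier.integral_comp_mul_eq [CompactSpace X] {u : C(X, ℝ)} (hu : IsMultiplier u)
    {μ ν : Measure X} (hμ : μ ∈ M1 (closure (ext X))) (hν : ν ∈ M1 (closure (ext X)))
    (h : SameBarycenter μ ν) {a : C(X, ℝ)} (ha : a ∈ Ac X) (g : C(ℝ, ℝ)) :
    ∫ x, g (u x) * a x ∂μ = ∫ x, g (u x) * a x ∂ν := by
  obtain ⟨x, hxμ, hxν⟩ := h
  have := hμ.1
  have := hν.1
  let S : Set C(X, ℝ) := {f | ∫ y, (f * a) y ∂μ = ∫ y, (f * a) y ∂ν}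
  have hS : IsClosed S := isClosed_eq
    ((continuous_integral_continuousMap μ).comp (continuous_id.mul continuous_const))
    ((continuous_integral_continuousMap ν).comp (continuous_id.mul continuous_const))
  have hsub : (multiplierAlgebra X : Set C(X, ℝ)) ⊆ S := by
    intro f hf
    obtain ⟨b, hb, hba⟩ := hf a ha
    have hF : Set.EqOn (f * a) b (closure (ext X)) :=
      Set.EqOn.closure (fun y hy ↦ (hba y hy).symm) (f * a).continuous b.continuous
    change ∫ y, (f * a) y ∂μ = ∫ y, (f * a) y ∂ν
    rw [integral_congr_of_mem_M1 hμ hF, integral_congr_of_mem_M1 hν hF, ← hxμ b hb, ← hxν b hb]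
  exact closure_minimal hsub hS (ContinuousMap.comp_attachBound_mem_closure (multiplierAlgebra X)
    ⟨u, hu.2⟩ (g.restrict _))

lemma IsMultiplier.setIntegral_eq [CompactSpace X] {u : C(X, ℝ)} (hu : IsMultiplier u)
    {μ ν : Measure X} (hμ : μ ∈ M1 (closure (ext X))) (hν : ν ∈ M1 (closure (ext X)))
    (h : SameBarycenter μ ν) {a : C(X, ℝ)} (ha : a ∈ Ac X) {B : Set ℝ} (hB : MeasurableSet B) :
    ∫ x in u ⁻¹' B, a x ∂μ = ∫ x in u ⁻¹' B, a x ∂ν := by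
  have := hμ.1
  have := hν.1
  obtain ⟨c, hc, hcA⟩ := exists_nonneg_add_const ha
  have h₁ := setIntegral_preimage_eq_of_forall_continuous hc
    (hu.integral_comp_mul_eq hμ hν h hcA) hB
  have h₂ := setIntegral_preimage_eq_of_forall_continuous (a := 1) (fun _ ↦ zero_le_one)
    (hu.integral_comp_mul_eq hμ hν h one_mem_Ac) hB
  simp only [ContinuousMap.add_apply, ContinuousMap.const_apply] at h₁
  rw [integral_add (integrable_continuousMap a _) (integrable_const _),
    integral_add (integrable_continuousMap a _) (integrable_const _)] at h₁
  simp only [ContinuousMap.one_apply, integral_const, smul_eq_mul, mul_one] at h₁ h₂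
  rw [h₂] at h₁
  exact add_right_cancel h₁

lemma IsMultiplier.measure_preimage_eq [CompactSpace X] {u : C(X, ℝ)} (hu : IsMultiplier u)
    {μ ν : Measure X} (hμ : μ ∈ M1 (closure (ext X))) (hν : ν ∈ M1 (closure (ext X)))
    (h : SameBarycenter μ ν) {B : Set ℝ} (hB : MeasurableSet B) :
    μ (u ⁻¹' B) = ν (u ⁻¹' B) := by
  have := hμ.1
  have := hν.1
  have h₁ := hu.setIntegral_eq hμ hν h one_mem_Ac hB
  simp only [ContinuousMap.one_apply, integral_const, smul_eq_mul, mul_one, Measure.real,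
    Measure.restrict_apply_univ] at h₁
  exact (ENNReal.toReal_eq_toReal_iff' (measure_ne_top _ _) (measure_ne_top _ _)).1 h₁

lemma IsMultiplier.sameBarycenter_cond [CompactSpace X] (hX : Convex ℝ X) {u : C(X, ℝ)}
    (hu : IsMultiplier u) {μ ν : Measure X} (hμ : μ ∈ M1 (closure (ext X)))
    (hν : ν ∈ M1 (closure (ext X))) (h : SameBarycenter μ ν) {B : Set ℝ} (hB : MeasurableSet B)
    (hpos : 0 < μ (u ⁻¹' B)) :
    SameBarycenter (ProbabilityTheory.cond μ (u ⁻¹' B)) (ProbabilityTheory.cond ν (u ⁻¹' B)) := by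
  have := hμ.1
  have := ProbabilityTheory.cond_isProbabilityMeasure hpos.ne'
  obtain ⟨x, hx⟩ := exists_isBarycenter hX (ProbabilityTheory.cond μ (u ⁻¹' B))
  refine ⟨x, hx, fun a ha ↦ ?_⟩
  rw [hx a ha, integral_cond_eq, integral_cond_eq, hu.setIntegral_eq hμ hν h ha hB, Measure.real,
    Measure.real, hu.measure_preimage_eq hμ hν h hB]

/-- Agreement of the conditional measures along the level sets of `u` integrates to agreement of
the integrals of `u a`. -/
lemma integral_mul_eq_of_cond [CompactSpace X] {u : C(X, ℝ)} (hu : u ∈ Ac X)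
    {μ ν : Measure X} (hμ : IsProbabilityMeasure μ) (hν : IsProbabilityMeasure ν)
    (h : SameBarycenter μ ν)
    (H : ∀ B : Set ℝ, MeasurableSet B → μ (u ⁻¹' B) = ν (u ⁻¹' B) ∧
      (0 < μ (u ⁻¹' B) → SameBarycenter
        (ProbabilityTheory.cond μ (u ⁻¹' B)) (ProbabilityTheory.cond ν (u ⁻¹' B))))
    {a : C(X, ℝ)} (ha : a ∈ Ac X) : ∫ x, u x * a x ∂μ = ∫ x, u x * a x ∂ν := by
  obtain ⟨c, hc, hcA⟩ := exists_nonneg_add_const ha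
  have key := integral_mul_eq_of_forall_setIntegral (u := u) hc (μ := μ) (ν := ν) fun B hB ↦ by
    obtain ⟨hB₁, hB₂⟩ := H B hB
    rcases (zero_le (a := μ (u ⁻¹' B))).eq_or_lt with h₀ | h₀
    · rw [Measure.restrict_eq_zero.2 h₀.symm, Measure.restrict_eq_zero.2 (hB₁.symm.trans h₀.symm)]
    · have h' := (hB₂ h₀).integral_eq hcA
      rw [integral_cond_eq, integral_cond_eq, Measure.real, Measure.real, ← hB₁] at h'
      exact mul_left_cancel₀
        (inv_ne_zero (ENNReal.toReal_pos h₀.ne' (measure_ne_top _ _)).ne') h'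
  simp only [ContinuousMap.add_apply, ContinuousMap.const_apply, mul_add] at key
  have hi : ∀ (ρ : Measure X) [IsFiniteMeasure ρ], Integrable (fun x ↦ u x * a x) ρ :=
    fun ρ _ ↦ integrable_continuousMap (u * a) ρ
  rw [integral_add (hi μ) ((integrable_continuousMap u _).mul_const c),
    integral_add (hi ν) ((integrable_continuousMap u _).mul_const c), integral_mul_const,
    integral_mul_const, h.integral_eq hu] at key
  exact add_right_cancel key

/-! ### Extending functions from the closure of the extreme points -/

section

variable {E : Type*} [AddCommGroup E] [Module ℝ E] [TopologicalSpace E] {X : Set E}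

/-- A function that is the infimum of the concave majorants of `h` on `F` is upper semicontinuous
and concave. -/
lemma eventually_lt_and_concave_of_isGLB_concave {b : X → ℝ} {h : C(X, ℝ)} {F : Set X}
    (hle : ∀ k : C(X, ℝ), IsConvexFun (-k) → (∀ x ∈ F, h x ≤ k x) → ∀ x, b x ≤ k x)
    (hlt : ∀ x r, b x < r → ∃ k : C(X, ℝ), IsConvexFun (-k) ∧ (∀ x ∈ F, h x ≤ k x) ∧ k x < r) :
    (∀ x r, b x < r → ∀ᶠ y in 𝓝 x, b y < r) ∧
      ∀ x y z : X, ∀ s t : ℝ, 0 ≤ s → 0 ≤ t → s + t = 1 →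
        (z : E) = s • (x : E) + t • (y : E) → s * b x + t * b y ≤ b z := by
  constructor
  · intro x r hr
    obtain ⟨k, hk, hhk, hkr⟩ := hlt x r hr
    filter_upwards [k.continuous.continuousAt.eventually_lt continuousAt_const hkr] with y hy
    exact (hle k hk hhk y).trans_lt hy
  · intro x y z s t hs ht hst hz
    by_contra! hlt'
    obtain ⟨k, hk, hhk, hkr⟩ := hlt z _ hlt'
    have h₁ := hk x y z s t hs ht hst hz
    have h₂ := mul_le_mul_of_nonneg_left (hle k hk hhk x) hs
    have h₃ := mul_le_mul_of_nonneg_left (hle k hk hhk y) ht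
    simp only [ContinuousMap.neg_apply] at h₁
    linarith

end

/-- `h` extends from the closure of `ext X` to an affine continuous function on `X` as soon as its
integral against a measure on that closure only depends on the barycenter. The value of the
extension at `x` is this integral: it is the infimum of the concave majorants of `h` as well as the
supremum of its convex minorants, hence semicontinuous from both sides and affine. -/
lemma exists_mem_Ac_eqOn_closure_ext [IsTopologicalAddGroup E] [ContinuousSMul ℝ E]
    [LocallyConvexSpace ℝ E] [T2Space E] [CompactSpace X] {h : C(X, ℝ)}
    (H : ∀ μ ∈ M1 (closure (ext X)), ∀ ν ∈ M1 (closure (ext X)), SameBarycenter μ ν →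
      ∫ x, h x ∂μ = ∫ x, h x ∂ν) :
    ∃ b ∈ Ac X, ∀ x ∈ closure (ext X), b x = h x := by
  choose μ hμ hμx hμk _ using fun x ↦ exists_mem_M1_closure_ext_isBarycenter x h
  let b : X → ℝ := fun x ↦ ∫ y, h y ∂(μ x)
  obtain ⟨hup, hconc⟩ := eventually_lt_and_concave_of_isGLB_concave (b := b) (h := h)
    (F := closure (ext X))
    (fun k hk hhk x ↦ (integral_mono_of_mem_M1 (hμ x) hhk).trans (hμk x k hk)) (by
      intro x r hr
      by_contra! hcon
      obtain ⟨ν, hν, hνx, -, hνr⟩ := exists_mem_M1_closure_ext_isBarycenter x h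
      have := hνr r hcon
      rw [H ν hν (μ x) (hμ x) ⟨x, hνx, hμx x⟩] at this
      exact hr.not_ge this)
  obtain ⟨hlow, hconv⟩ := eventually_lt_and_concave_of_isGLB_concave (b := -b) (h := -h)
    (F := closure (ext X))
    (fun k hk hhk x ↦ by
      have := (integral_mono_of_mem_M1 (hμ x) hhk).trans (hμk x k hk)
      simp only [ContinuousMap.neg_apply, integral_neg] at this
      exact this) (by
      intro x r hr
      by_contra! hcon
      obtain ⟨ν, hν, hνx, -, hνr⟩ := exists_mem_M1_closure_ext_isBarycenter x (-h)
      have := hνr r hcon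
      simp only [ContinuousMap.neg_apply, integral_neg] at this
      rw [H ν hν (μ x) (hμ x) ⟨x, hνx, hμx x⟩] at this
      exact hr.not_ge this)
  have hb : Continuous b := continuous_iff_continuousAt.2 fun x ↦ tendsto_order.2
    ⟨fun r hr ↦ (hlow x (-r) (neg_lt_neg hr)).mono fun y hy ↦ neg_lt_neg_iff.1 hy, hup x⟩
  refine ⟨⟨b, hb⟩, fun x y z s t hs ht hst hz ↦ ?_, fun x hx ↦ ?_⟩
  · have h₁ := hconc x y z s t hs ht hst hz
    have h₂ := hconv x y z s t hs ht hst hz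
    simp only [Pi.neg_apply] at h₂
    change b z = s * b x + t * b y
    linarith
  · obtain ⟨δ, hδ, hδx⟩ := exists_mem_M1_singleton x
    exact (H (μ x) (hμ x) δ (mem_M1_of_subset (Set.singleton_subset_iff.2 hx) hδ)
      ⟨x, hμx x, fun a _ ↦ (hδx a).symm⟩).trans (hδx h)

end

/-! ### Maximal measures -/

section

variable {E : Type*} [AddCommGroup E] [Module ℝ E] [TopologicalSpace E] [IsTopologicalAddGroup E]
  [ContinuousSMul ℝ E] [LocallyConvexSpace ℝ E] [T2Space E] {X : Set E}

lemma exists_mem_Ac_apply_eq (v : X → ℝ) (x y : X) : ∃ a ∈ Ac X, a x = v x ∧ a y = v y := by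
  rcases eq_or_ne x y with rfl | hxy
  · exact ⟨_, const_mem_Ac (v x), rfl, rfl⟩
  obtain ⟨l, hl⟩ := geometric_hahn_banach_point_point (Subtype.coe_injective.ne hxy)
  let L : C(X, ℝ) := ⟨fun z ↦ l z, l.continuous.comp continuous_subtype_val⟩
  have hL : L ∈ Ac X := fun x y z s t _ _ _ hz ↦ by
    simp only [L, ContinuousMap.coe_mk, hz, map_add, map_smul, smul_eq_mul]
  have hne : L y - L x ≠ 0 := sub_ne_zero.2 hl.ne'
  refine ⟨ContinuousMap.const X (v x) +
    ((v y - v x) / (L y - L x)) • (L - ContinuousMap.const X (L x)),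
    (Ac X).add_mem (const_mem_Ac _) ((Ac X).smul_mem _ ((Ac X).sub_mem hL (const_mem_Ac _))),
    ?_, ?_⟩
  · simp
  · simp only [ContinuousMap.add_apply, ContinuousMap.const_apply, ContinuousMap.smul_apply,
      ContinuousMap.sub_apply, smul_eq_mul, div_mul_cancel₀ _ hne]
    ring

/-- Differences of continuous convex functions form a vector lattice that separates points, hence
are dense in `C(X)`. -/
lemma closure_sub_convex_eq_top [CompactSpace X] :
    closure {g : C(X, ℝ) | ∃ f₁ f₂, IsConvexFun f₁ ∧ IsConvexFun f₂ ∧ g = f₁ - f₂} = ⊤ := by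
  have hsup : ∀ f₁ f₂ g₁ g₂ : C(X, ℝ),
      (f₁ - f₂) ⊔ (g₁ - g₂) = (f₁ + g₂) ⊔ (g₁ + f₂) - (f₂ + g₂) := by
    intro f₁ f₂ g₁ g₂
    ext x
    simp only [ContinuousMap.sup_apply, ContinuousMap.sub_apply, ContinuousMap.add_apply]
    rw [← max_sub_sub_right]
    congr 1 <;> ring
  have hinf : ∀ f₁ f₂ g₁ g₂ : C(X, ℝ),
      (f₁ - f₂) ⊓ (g₁ - g₂) = (f₁ + g₁) - (f₂ + g₁) ⊔ (g₂ + f₁) := by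
    intro f₁ f₂ g₁ g₂
    ext x
    simp only [ContinuousMap.inf_apply, ContinuousMap.sup_apply, ContinuousMap.sub_apply,
      ContinuousMap.add_apply]
    rw [← min_sub_sub_left]
    congr 1 <;> ring
  refine ContinuousMap.sublattice_closure_eq_top _ ⟨0, 0, 0, ?_, ?_, by simp⟩ ?_ ?_ ?_
  · exact isConvexFun_of_mem_Ac (Ac X).zero_mem
  · exact isConvexFun_of_mem_Ac (Ac X).zero_mem
  · rintro _ ⟨f₁, f₂, hf₁, hf₂, rfl⟩ _ ⟨g₁, g₂, hg₁, hg₂, rfl⟩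
    exact ⟨_, _, hf₁.add hg₁, (hf₂.add hg₁).sup (hg₂.add hf₁), hinf _ _ _ _⟩
  · rintro _ ⟨f₁, f₂, hf₁, hf₂, rfl⟩ _ ⟨g₁, g₂, hg₁, hg₂, rfl⟩
    exact ⟨_, _, (hf₁.add hg₂).sup (hg₁.add hf₂), hf₂.add hg₂, hsup _ _ _ _⟩
  · intro v x y
    obtain ⟨a, ha, hax, hay⟩ := exists_mem_Ac_apply_eq v x y
    exact ⟨a, ⟨a, 0, isConvexFun_of_mem_Ac ha, isConvexFun_of_mem_Ac (Ac X).zero_mem, by simp⟩,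
      hax, hay⟩

variable [CompactSpace X] [MeasurableSpace E] [BorelSpace E]

lemma DilationLE.antisymm {μ ν : Measure X} (hμ : μ ∈ M1 (Set.univ : Set X))
    (hν : ν ∈ M1 (Set.univ : Set X)) (h₁ : DilationLE μ ν) (h₂ : DilationLE ν μ) : μ = ν := by
  have := hμ.1
  have := hν.1
  have := hμ.2.1
  have := hν.2.1
  refine Measure.ext_of_integral_eq_on_compactlySupported fun f ↦ ?_
  let S : Set C(X, ℝ) := {g | ∫ x, g x ∂μ = ∫ x, g x ∂ν}
  have hS : IsClosed S :=
    isClosed_eq (continuous_integral_continuousMap μ) (continuous_integral_continuousMap ν)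
  refine closure_minimal (t := S) ?_ hS
    (closure_sub_convex_eq_top.ge (Set.mem_univ f.toContinuousMap))
  rintro _ ⟨f₁, f₂, hf₁, hf₂, rfl⟩
  simp only [S, Set.mem_ofPred_eq, ContinuousMap.sub_apply]
  rw [integral_sub (integrable_continuousMap f₁ μ) (integrable_continuousMap f₂ μ),
    integral_sub (integrable_continuousMap f₁ ν) (integrable_continuousMap f₂ ν),
    (h₁ f₁ hf₁).antisymm (h₂ f₁ hf₁), (h₁ f₂ hf₂).antisymm (h₂ f₂ hf₂)]

/-- Zorn's lemma yields a maximal measure above any given one. -/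
lemma exists_isMaximalMeasure_dilationLE {μ : Measure X} (hμ : μ ∈ M1 (Set.univ : Set X)) :
    ∃ m, IsMaximalMeasure m ∧ DilationLE μ m := by
  let T := {ν : Measure X // ν ∈ M1 (Set.univ : Set X) ∧ DilationLE μ ν}
  obtain ⟨⟨m, hm, hμm⟩, hmax⟩ := exists_maximal_of_chains_bounded
    (r := fun ν ρ : T ↦ DilationLE ν.1 ρ.1) (fun c hc ↦ by
      rcases c.eq_empty_or_nonempty with rfl | ⟨ν₀, hν₀⟩
      · exact ⟨⟨μ, hμ, DilationLE.refl μ⟩, by simp⟩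
      obtain ⟨ρ, hρ, hcρ, -⟩ := exists_mem_M1_closure_ext_dilationLE (C := Subtype.val '' c)
        (by rintro _ ⟨ν, -, rfl⟩; exact ν.2.1) ⟨_, ν₀, hν₀, rfl⟩ (by
          rintro _ ⟨ν, hν, rfl⟩ _ ⟨ν', hν', rfl⟩
          rcases eq_or_ne ν ν' with rfl | hne
          · exact ⟨ν, ⟨ν, hν, rfl⟩, DilationLE.refl _, DilationLE.refl _⟩
          rcases hc hν hν' hne with h | h
          · exact ⟨ν', ⟨ν', hν', rfl⟩, h, DilationLE.refl _⟩
          · exact ⟨ν, ⟨ν, hν, rfl⟩, DilationLE.refl _, h⟩) 0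
      exact ⟨⟨ρ, M1_subset_univ hρ, ν₀.2.2.trans (hcρ _ ⟨ν₀, hν₀, rfl⟩)⟩,
        fun ν hν ↦ hcρ _ ⟨ν, hν, rfl⟩⟩) fun h₁ h₂ ↦ h₁.trans h₂
  exact ⟨m, ⟨hm, fun ν hν hmν ↦
    (hmν.antisymm hm hν (hmax ⟨ν, hν, hμm.trans hmν⟩ hmν)).symm⟩, hμm⟩

/-- Maximal measures are supported by the closure of `ext X`. -/
lemma IsMaximalMeasure.mem_M1_closure_ext {m : Measure X} (hm : IsMaximalMeasure m) :
    m ∈ M1 (closure (ext X)) := by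
  obtain ⟨ρ, hρ, hmρ, -⟩ := exists_mem_M1_closure_ext_dilationLE (C := {m})
    (Set.singleton_subset_iff.2 hm.1) (Set.singleton_nonempty m)
    (fun _ h₁ _ h₂ ↦ ⟨m, rfl, h₁ ▸ DilationLE.refl m, h₂ ▸ DilationLE.refl m⟩) 0
  exact hm.2 ρ (M1_subset_univ hρ) (hmρ m rfl) ▸ hρ

/-! ### Functions satisfying the barycentric formula on the closure of the extreme points -/

/-- If `h(x)` is the integral of `h` against each measure on the closure of `ext X` representing a
point `x` of that closure, then `h` is there the infimum of its concave majorants. These being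
closed under finite minima, compactness makes the approximation uniform. -/
lemma exists_concave_le_add {h : C(X, ℝ)}
    (H : ∀ x ∈ closure (ext X), ∀ μ ∈ M1 (closure (ext X)), IsBarycenter μ x →
      ∫ y, h y ∂μ = h x) {ε : ℝ} (hε : 0 < ε) :
    ∃ k : C(X, ℝ), IsConvexFun (-k) ∧ (∀ x ∈ closure (ext X), h x ≤ k x) ∧
      ∀ x ∈ closure (ext X), k x ≤ h x + ε := by
  refine (isClosed_closure (s := ext X)).isCompact.induction_on (p := fun s ↦ ∃ k : C(X, ℝ),
    IsConvexFun (-k) ∧ (∀ x ∈ closure (ext X), h x ≤ k x) ∧ ∀ x ∈ s, k x ≤ h x + ε) ?_ ?_ ?_ ?_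
  · exact ⟨ContinuousMap.const X ‖h‖, isConvexFun_of_mem_Ac ((Ac X).neg_mem (const_mem_Ac _)),
      fun x _ ↦ h.apply_le_norm x, by simp⟩
  · rintro s t hst ⟨k, hk, hhk, hkt⟩
    exact ⟨k, hk, hhk, fun x hx ↦ hkt x (hst hx)⟩
  · rintro s t ⟨k, hk, hhk, hks⟩ ⟨k', hk', hhk', hkt⟩
    refine ⟨k ⊓ k', ?_, fun x hx ↦ le_min (hhk x hx) (hhk' x hx), ?_⟩
    · have : -(k ⊓ k') = -k ⊔ -k' := by
        ext x
        simp only [ContinuousMap.neg_apply, ContinuousMap.inf_apply, ContinuousMap.sup_apply]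
        exact (max_neg_neg _ _).symm
      rw [this]
      exact hk.sup hk'
    · rintro x (hx | hx)
      · exact (min_le_left _ _).trans (hks x hx)
      · exact (min_le_right _ _).trans (hkt x hx)
  · intro x hx
    obtain ⟨k, hk, hhk, hkx⟩ : ∃ k : C(X, ℝ), IsConvexFun (-k) ∧
        (∀ x ∈ closure (ext X), h x ≤ k x) ∧ k x < h x + ε := by
      by_contra! hcon
      obtain ⟨μ, hμ, hμx, -, hμr⟩ := exists_mem_M1_closure_ext_isBarycenter x h
      have := hμr _ hcon
      rw [H x hx μ hμ hμx] at this
      linarith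
    refine ⟨_, mem_nhdsWithin_of_mem_nhds (k.continuous.continuousAt.eventually_lt
      (h.continuous.add continuous_const).continuousAt hkx), k, hk, hhk, fun y hy ↦ hy.le⟩

lemma DilationLE.integral_le_of_barycentric {h : C(X, ℝ)}
    (H : ∀ x ∈ closure (ext X), ∀ μ ∈ M1 (closure (ext X)), IsBarycenter μ x →
      ∫ y, h y ∂μ = h x) {μ ν : Measure X} (hμ : μ ∈ M1 (closure (ext X)))
    (hν : ν ∈ M1 (closure (ext X))) (hμν : DilationLE μ ν) : ∫ x, h x ∂ν ≤ ∫ x, h x ∂μ := by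
  have := hμ.1
  refine le_of_forall_pos_le_add fun ε hε ↦ ?_
  obtain ⟨k, hk, hhk, hkε⟩ := exists_concave_le_add H hε
  calc ∫ x, h x ∂ν ≤ ∫ x, k x ∂ν := integral_mono_of_mem_M1 hν hhk
    _ ≤ ∫ x, k x ∂μ := hμν.integral_concave_le hk
    _ ≤ ∫ x, (h + ContinuousMap.const X ε) x ∂μ := integral_mono_of_mem_M1 hμ hkε
    _ = ∫ x, h x ∂μ + ε := by
      simp only [ContinuousMap.add_apply, ContinuousMap.const_apply]
      rw [integral_add (integrable_continuousMap h μ) (integrable_const ε)]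
      simp

lemma DilationLE.integral_eq_of_barycentric {h : C(X, ℝ)}
    (H : ∀ x ∈ closure (ext X), ∀ μ ∈ M1 (closure (ext X)), IsBarycenter μ x →
      ∫ y, h y ∂μ = h x) {μ ν : Measure X} (hμ : μ ∈ M1 (closure (ext X)))
    (hν : ν ∈ M1 (closure (ext X))) (hμν : DilationLE μ ν) : ∫ x, h x ∂ν = ∫ x, h x ∂μ := by
  refine (hμν.integral_le_of_barycentric H hμ hν).antisymm ?_
  have h' := hμν.integral_le_of_barycentric (h := -h) (fun x hx ρ hρ hρx ↦ by
    simp only [ContinuousMap.neg_apply, integral_neg, H x hx ρ hρ hρx]) hμ hν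
  simp only [ContinuousMap.neg_apply, integral_neg] at h'
  exact neg_le_neg_iff.1 h'

/-- On a simplex, two measures on the closure of `ext X` with a common barycenter lie below a common
maximal measure. -/
lemma IsSimplex.integral_eq_of_barycentric (hX : IsSimplex X) {h : C(X, ℝ)}
    (H : ∀ x ∈ closure (ext X), ∀ μ ∈ M1 (closure (ext X)), IsBarycenter μ x →
      ∫ y, h y ∂μ = h x) {μ ν : Measure X} (hμ : μ ∈ M1 (closure (ext X)))
    (hν : ν ∈ M1 (closure (ext X))) (hμν : SameBarycenter μ ν) :
    ∫ x, h x ∂μ = ∫ x, h x ∂ν := by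
  obtain ⟨x, hμx, hνx⟩ := hμν
  obtain ⟨m, hm, hμm⟩ := exists_isMaximalMeasure_dilationLE (M1_subset_univ hμ)
  obtain ⟨m', hm', hνm'⟩ := exists_isMaximalMeasure_dilationLE (M1_subset_univ hν)
  obtain rfl := (hX x).unique ⟨hm, hμm.isBarycenter hμx⟩ ⟨hm', hνm'.isBarycenter hνx⟩
  rw [← hμm.integral_eq_of_barycentric H hμ hm.mem_M1_closure_ext,
    hνm'.integral_eq_of_barycentric H hν hm.mem_M1_closure_ext]

end

/-! ### Functions that are constant on supports -/

section

variable {E : Type*} [AddCommGroup E] [Module ℝ E] [TopologicalSpace E] [MeasurableSpace E]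
  {X : Set E}

lemma integral_mul_eq_of_support {u a : C(X, ℝ)} (hu : u ∈ Ac X) (ha : a ∈ Ac X) {F : Set X}
    {μ : Measure X} (hμ : μ ∈ M1 F) {x : X} (hx : IsBarycenter μ x)
    (h : ∀ y ∈ μ.support, ∀ z ∈ μ.support, u y = u z) : ∫ y, (u * a) y ∂μ = (u * a) x := by
  have := hμ.1
  have := hμ.2.1
  have hsupp : ∀ᵐ y ∂μ, y ∈ μ.support := Measure.support_mem_ae_of_regular
  obtain ⟨z, hz⟩ := hsupp.exists
  have hc : ∀ᵐ y ∂μ, u y = u z := hsupp.mono fun y hy ↦ h y hy z hz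
  have hux : u x = u z := by
    rw [hx u hu, integral_congr_ae hc]
    simp
  rw [ContinuousMap.mul_apply, hx a ha, hux, ← integral_const_mul]
  exact integral_congr_ae (hc.mono fun y hy ↦ by rw [ContinuousMap.mul_apply, hy])

variable [T2Space E] [BorelSpace E] [CompactSpace X]

lemma IsMultiplier.eq_of_mem_support {u : C(X, ℝ)} (hu : IsMultiplier u) {μ : Measure X}
    (hμ : μ ∈ M1 (closure (ext X))) {x : X} (hx : x ∈ closure (ext X)) (hμx : IsBarycenter μ x)
    {y : X} (hy : y ∈ μ.support) : u y = u x := by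
  obtain ⟨δ, hδ, hδx⟩ := exists_mem_M1_singleton x
  have h := hu.measure_preimage_eq hμ (mem_M1_of_subset (Set.singleton_subset_iff.2 hx) hδ)
    ⟨x, hμx, fun a _ ↦ (hδx a).symm⟩ (measurableSet_singleton (u x)).compl
  have hδ₀ : δ (u ⁻¹' {u x}ᶜ) = 0 :=
    measure_mono_null (Set.subset_compl_comm.2 (by simp)) hδ.2.2
  rw [hδ₀] at h
  exact Measure.support_subset_of_isClosed (isClosed_singleton.preimage u.continuous)
    (mem_ae_iff.2 h) hy

end

end CompactConvex

theorem mainTheorem9 {E : Type*} [AddCommGroup E] [Module ℝ E] [TopologicalSpace E]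
    [IsTopologicalAddGroup E] [ContinuousSMul ℝ E] [LocallyConvexSpace ℝ E] [T2Space E]
    [MeasurableSpace E] [BorelSpace E]
    (X : Set E) (hXcompact : IsCompact X) (hXconvex : Convex ℝ X)
    (u : C(X, ℝ)) (hu : u ∈ CompactConvex.Ac X) :
    (CompactConvex.IsMultiplier u ↔
      ∀ μ ∈ CompactConvex.M1 (closure (CompactConvex.ext X)),
      ∀ ν ∈ CompactConvex.M1 (closure (CompactConvex.ext X)),
        CompactConvex.SameBarycenter μ ν →
        ∀ B : Set ℝ, MeasurableSet B →
          μ (u ⁻¹' B) = ν (u ⁻¹' B) ∧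
          (0 < μ (u ⁻¹' B) →
            CompactConvex.SameBarycenter
              (ProbabilityTheory.cond μ (u ⁻¹' B)) (ProbabilityTheory.cond ν (u ⁻¹' B)))) ∧
    (CompactConvex.IsSimplex X →
      (CompactConvex.IsMultiplier u ↔
        ∀ μ ∈ CompactConvex.M1 (closure (CompactConvex.ext X)),
        ∀ x ∈ closure (CompactConvex.ext X), CompactConvex.IsBarycenter μ x →
          ∀ y ∈ μ.support, ∀ z ∈ μ.support, u y = u z)) := by
  have : CompactSpace X := isCompact_iff_compactSpace.1 hXcompact
  refine ⟨⟨fun h μ hμ ν hν hμν B hB ↦ ⟨h.measure_preimage_eq hμ hν hμν hB,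
    h.sameBarycenter_cond hXconvex hμ hν hμν hB⟩, fun H ↦ ⟨hu, fun a ha ↦ ?_⟩⟩,
    fun hX ↦ ⟨fun h μ hμ x hx hμx y hy z hz ↦ ?_, fun H ↦ ⟨hu, fun a ha ↦ ?_⟩⟩⟩
  · obtain ⟨b, hb, hbu⟩ := CompactConvex.exists_mem_Ac_eqOn_closure_ext (h := u * a)
      fun μ hμ ν hν hμν ↦ CompactConvex.integral_mul_eq_of_cond hu hμ.1 hν.1 hμν
        (H μ hμ ν hν hμν) ha
    exact ⟨b, hb, fun x hx ↦ hbu x (subset_closure hx)⟩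
  · rw [h.eq_of_mem_support hμ hx hμx hy, h.eq_of_mem_support hμ hx hμx hz]
  · obtain ⟨b, hb, hbu⟩ := CompactConvex.exists_mem_Ac_eqOn_closure_ext (h := u * a)
      fun μ hμ ν hν hμν ↦ hX.integral_eq_of_barycentric (fun x hx ρ hρ hρx ↦
        CompactConvex.integral_mul_eq_of_support hu ha hρ hρx (H ρ hρ x hx hρx)) hμ hν hμν
    exact ⟨b, hb, fun x hx ↦ hbu x (subset_closure hx)⟩
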